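/- For a prime $p$ let $p^+$ be the least prime greater than $p$, let $p^{+(0)}=p$ and $p^{+(j+1)}=(p^{+(j)})^+$, and let $g(p)=p^+-p$. For $t\ge 1$ put $$\mathbf G^{(t)}(p)=\bigl(g(p),g(p^{+}),\dots,g(p^{+(t-1)})\bigr)\in\mathbb N^t .$$ For real $X\ge 2$ let $P$ be uniformly distributed on the (nonempty, finite) set of primes in $[X,2X]$, and put $\mathbf G^{(t)}_X=\mathbf G^{(t)}(P)$. Theorem. For every integer $t\ge 1$ there are constants $C_t>0$, $A_t\in\mathbb Z_{\ge0}$ and $X_t$, depending only on $t$, such that for all real $X\ge X_t$ and all finite sets $\mathcal S\subseteq\mathbb N^t$, $$\Pr\bigl[\mathbf G^{(t)}_X\in\mathcal S\bigr]\le C_t\,\frac{|\mathcal S|\,(\log\log(3X))^{A_t}}{(\log X)^t}.$$ -/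

import Mathlib

noncomputable section

namespace PrimeGaps

/-- The set of primes in the dyadic interval `[X, 2X]`, for real `X`. -/
def dyadicPrimes (X : ℝ) : Set ℕ := {p : ℕ | p.Prime ∧ X ≤ (p : ℝ) ∧ (p : ℝ) ≤ 2 * X}

theorem exists_prime_gt (n : ℕ) : ∃ q : ℕ, n < q ∧ q.Prime := by
  obtain ⟨q, hq, hp⟩ := Nat.exists_infinite_primes (n + 1)
  exact ⟨q, hq, hp⟩

open Classical in
/-- The least prime strictly greater than `n`. -/
def nextPrime (n : ℕ) : ℕ := Nat.find (exists_prime_gt n)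

/-- The gap from `p` to the next prime (no truncation occurs, since `p < nextPrime p`). -/
def gap (p : ℕ) : ℕ := nextPrime p - p

/-- The vector of `t` consecutive gaps starting at `p`:
its `j`-th entry (`0 ≤ j < t`) is the gap after the `j`-th successor prime of `p`. -/
def gapVector (t : ℕ) (p : ℕ) : Fin t → ℕ := fun j => gap (nextPrime^[(j : ℕ)] p)

/-- The law of the gap vector `gapVector t P` for `P` uniformly distributed on the primes in
`[X, 2X]` (a finite set, and a nonempty one for `1 ≤ X`). -/
def gapVectorLaw (t : ℕ) (X : ℝ) : MeasureTheory.Measure (Fin t → ℕ) :=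
  (ProbabilityTheory.uniformOn (dyadicPrimes X)).map (gapVector t)

end PrimeGaps

end

/-!
Primes with the same gap vector as a fixed prime `q` share with it the offsets to their next `t`
successors, so each such prime `p` makes `p + h` prime for all `h` in one set of `t + 1` offsets.
Brun's pure sieve, with sieving level `X ^ (c / log log X)`, bounds the number of such `p` in
`[X, 2X]` by `X / (log X) ^ (t + 1)` up to powers of `log log X`. The offsets only need to be at
most a power of `X`: the primes dividing one of their differences are left out of the sieve, at the
cost of another power of `log log X`. Chebyshev's lower bound `≫ X / log X` for the number of primes
in `[X, 2X]` turns this count into a bound for the probability of a single gap vector.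
-/

namespace PrimeGaps

open Finset

section BrunSieve

variable {ι α : Type*}

lemma sum_powerset_filter_card_le {M : Type*} [AddCommMonoid M] (U : Finset ι) (r : ℕ)
    (f : ℕ → M) :
    ∑ T ∈ U.powerset with #T ≤ r, f #T = ∑ j ∈ range (r + 1), (#U).choose j • f j := by
  have maps_to : ∀ T ∈ {T ∈ U.powerset | #T ≤ r}, #T ∈ range (r + 1) := fun T hT =>
    mem_range_succ_iff.2 (mem_filter.1 hT).2
  rw [← sum_fiberwise_of_maps_to maps_to]
  refine sum_congr rfl fun j hj => ?_
  have fiber_eq : {T ∈ {T ∈ U.powerset | #T ≤ r} | #T = j} = powersetCard j U := by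
    ext T
    simp only [mem_filter, mem_powerset, mem_powersetCard, mem_range] at hj ⊢
    grind
  rw [fiber_eq, sum_congr rfl fun T hT => congrArg f (mem_powersetCard.1 hT).2, sum_const,
    card_powersetCard]

lemma bonferroni_ite_eq_empty_le (U : Finset ι) {r : ℕ} (hr : Even r) [Decidable (U = ∅)] :
    (if U = ∅ then 1 else 0 : ℤ) ≤ ∑ T ∈ U.powerset with #T ≤ r, (-1) ^ #T := by
  rw [sum_powerset_filter_card_le U r fun j => (-1 : ℤ) ^ j]
  simp only [nsmul_eq_mul, mul_comm ((Nat.choose _ _ : ℕ) : ℤ)]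
  rcases Nat.eq_zero_or_eq_succ_pred #U with hU | hU
  · simp [card_eq_zero.1 hU, sum_range_succ']
  · have hne : U ≠ ∅ := by rintro rfl; simp at hU
    rw [if_neg hne, hU, Nat.succ_eq_add_one, Int.alternating_sum_range_choose_eq_choose,
      hr.neg_one_pow]
    positivity

lemma card_filter_forall_not_le_sum (I : Finset α) (P : Finset ι) (b : ι → α → Prop)
    [∀ p n, Decidable (b p n)] {r : ℕ} (hr : Even r) :
    (#{n ∈ I | ∀ p ∈ P, ¬ b p n} : ℤ) ≤
      ∑ T ∈ P.powerset with #T ≤ r, (-1) ^ #T * (#{n ∈ I | ∀ p ∈ T, b p n} : ℤ) := by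
  classical
  have powerset_eq (n : α) : {T ∈ ({p ∈ P | b p n}).powerset | #T ≤ r} =
      {T ∈ {T ∈ P.powerset | #T ≤ r} | ∀ p ∈ T, b p n} := by
    ext T
    simp only [mem_filter, mem_powerset, subset_iff]
    grind
  calc (#{n ∈ I | ∀ p ∈ P, ¬ b p n} : ℤ)
      = ∑ n ∈ I, if ({p ∈ P | b p n}) = ∅ then 1 else 0 := by
        rw [card_filter]
        push_cast
        simp only [filter_eq_empty_iff]
    _ ≤ ∑ n ∈ I, ∑ T ∈ ({p ∈ P | b p n}).powerset with #T ≤ r, (-1) ^ #T :=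
        sum_le_sum fun n _ => bonferroni_ite_eq_empty_le _ hr
    _ = ∑ T ∈ P.powerset with #T ≤ r, ∑ n ∈ I, if ∀ p ∈ T, b p n then (-1) ^ #T else 0 := by
        simp_rw [powerset_eq, sum_filter _ (s := {T ∈ P.powerset | #T ≤ r})]
        exact sum_comm
    _ = _ := by simp [← sum_filter, mul_comm]

lemma sum_pow_card_le {S : Type*} [CommSemiring S] [PartialOrder S] [IsOrderedRing S]
    (P : Finset ι) (r : ℕ) {k : S} (hk : 0 ≤ k) :
    ∑ T ∈ P.powerset with #T ≤ r, k ^ #T ≤ (1 + k * #P) ^ r := by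
  rw [sum_powerset_filter_card_le P r (k ^ ·), add_comm 1, add_pow]
  refine sum_le_sum fun j hj => ?_
  have choose_le : ((#P).choose j : S) ≤ (#P : S) ^ j :=
    (Nat.mono_cast (Nat.choose_le_pow #P j)).trans_eq (Nat.cast_pow _ _)
  have one_le_choose : (1 : S) ≤ r.choose j :=
    Nat.cast_one.symm.trans_le (Nat.mono_cast (Nat.choose_pos (mem_range_succ_iff.1 hj)))
  calc (#P).choose j • k ^ j ≤ #P ^ j * k ^ j := by rw [nsmul_eq_mul]; gcongr
    _ ≤ #P ^ j * k ^ j * r.choose j := le_mul_of_one_le_right (by positivity) one_le_choose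
    _ = _ := by ring

variable {R : Type*} [Field R] [LinearOrder R] [IsStrictOrderedRing R]

/-- Rankin's trick: the terms with `#T > r` are weighted by `z ^ (#T - r) ≥ 1` before summing. -/
lemma sum_prod_neg_le {P : Finset ι} {g : ι → R} (hg : ∀ p ∈ P, 0 ≤ g p) {z : R} (hz : 1 ≤ z)
    (r : ℕ) :
    ∑ T ∈ P.powerset with #T ≤ r, ∏ p ∈ T, -g p ≤
      ∏ p ∈ P, (1 - g p) + (z ^ r)⁻¹ * ∏ p ∈ P, (1 + z * g p) := by
  have : 0 < z := one_pos.trans_le hz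
  have prod_nonneg_of_mem {T : Finset ι} (hT : T ∈ P.powerset) : 0 ≤ ∏ p ∈ T, g p :=
    prod_nonneg fun p hp => hg p (mem_powerset.1 hT hp)
  have term_nonneg : ∀ T ∈ P.powerset, 0 ≤ (z ^ r)⁻¹ * ∏ p ∈ T, z * g p := fun T hT => by
    rw [prod_mul_distrib, prod_const]
    have := prod_nonneg_of_mem hT
    positivity
  have discarded_le : ∀ T ∈ P.powerset, ¬ #T ≤ r →
      -∏ p ∈ T, -g p ≤ (z ^ r)⁻¹ * ∏ p ∈ T, z * g p := fun T hT hr => by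
    have hpow : 1 ≤ (z ^ r)⁻¹ * z ^ #T := by
      rw [inv_mul_eq_div, one_le_div (by positivity)]
      exact pow_le_pow_right₀ hz (not_le.1 hr).le
    calc -∏ p ∈ T, -g p ≤ |∏ p ∈ T, -g p| := neg_le_abs _
      _ = ∏ p ∈ T, g p := by
        simp only [abs_prod, abs_neg]
        exact prod_congr rfl fun p hp => abs_of_nonneg (hg p (mem_powerset.1 hT hp))
      _ ≤ (z ^ r)⁻¹ * z ^ #T * ∏ p ∈ T, g p :=
        le_mul_of_one_le_left (prod_nonneg_of_mem hT) hpow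
      _ = _ := by rw [prod_mul_distrib, prod_const, mul_assoc]
  have discarded_sum_le :
      -∑ T ∈ P.powerset with ¬ #T ≤ r, ∏ p ∈ T, -g p ≤
        (z ^ r)⁻¹ * ∏ p ∈ P, (1 + z * g p) := by
    rw [prod_one_add, mul_sum, ← sum_neg_distrib]
    refine (sum_le_sum fun T hT => ?_).trans
      (sum_le_sum_of_subset_of_nonneg (filter_subset _ _) fun T hT _ => term_nonneg T hT)
    exact discarded_le T (mem_filter.1 hT).1 (mem_filter.1 hT).2
  have split := sum_filter_add_sum_filter_not P.powerset (#· ≤ r) fun T => ∏ p ∈ T, -g p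
  simp_rw [sub_eq_add_neg]
  rw [prod_one_add, ← split]
  linarith

theorem brun_pure_sieve (I : Finset α) {P : Finset ι} {b : ι → α → Prop}
    [∀ p n, Decidable (b p n)] {M k z : R} {g : ι → R} (hM : 0 ≤ M) (hk : 0 ≤ k) (hz : 1 ≤ z)
    (hg : ∀ p ∈ P, 0 ≤ g p)
    (hcount : ∀ T ⊆ P, |(#{n ∈ I | ∀ p ∈ T, b p n} : R) - M * ∏ p ∈ T, g p| ≤ k ^ #T)
    {r : ℕ} (hr : Even r) :
    (#{n ∈ I | ∀ p ∈ P, ¬ b p n} : R) ≤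
      M * (∏ p ∈ P, (1 - g p) + (z ^ r)⁻¹ * ∏ p ∈ P, (1 + z * g p)) + (1 + k * #P) ^ r := by
  have bonferroni : (#{n ∈ I | ∀ p ∈ P, ¬ b p n} : R) ≤
      ∑ T ∈ P.powerset with #T ≤ r, (-1) ^ #T * (#{n ∈ I | ∀ p ∈ T, b p n} : R) := by
    exact_mod_cast card_filter_forall_not_le_sum I P b hr
  have term_le : ∀ T ∈ {T ∈ P.powerset | #T ≤ r},
      (-1) ^ #T * (#{n ∈ I | ∀ p ∈ T, b p n} : R) ≤ M * ∏ p ∈ T, -g p + k ^ #T := fun T hT => by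
    have ⟨lower, upper⟩ := abs_le.1 (hcount T (mem_powerset.1 (mem_filter.1 hT).1))
    rw [prod_neg]
    rcases neg_one_pow_eq_or R #T with h | h <;> rw [h] <;> linarith
  calc (#{n ∈ I | ∀ p ∈ P, ¬ b p n} : R)
      ≤ ∑ T ∈ P.powerset with #T ≤ r, (M * ∏ p ∈ T, -g p + k ^ #T) :=
        bonferroni.trans (sum_le_sum term_le)
    _ = M * ∑ T ∈ P.powerset with #T ≤ r, ∏ p ∈ T, -g p
        + ∑ T ∈ P.powerset with #T ≤ r, k ^ #T := by rw [sum_add_distrib, mul_sum]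
    _ ≤ _ := by
        gcongr
        · exact sum_prod_neg_le hg hz r
        · exact sum_pow_card_le P r hk

end BrunSieve

section CongruenceConditions

open Function

lemma card_filter_range_mul_of_coprime {m n : ℕ} (hm : 0 < m) (hn : 0 < n) (h : m.Coprime n)
    {p q : ℕ → Prop} [DecidablePred p] [DecidablePred q] (hp : Periodic p m) (hq : Periodic q n) :
    #{x ∈ range (m * n) | p x ∧ q x} = #{x ∈ range m | p x} * #{x ∈ range n | q x} := by
  rw [← card_product]
  refine card_bij (fun x _ => (x % m, x % n)) (fun x hx => ?_) (fun x hx y hy hxy => ?_) ?_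
  · simp only [mem_filter, mem_range, mem_product, hp.map_mod_nat, hq.map_mod_nat] at hx ⊢
    exact ⟨⟨Nat.mod_lt _ hm, hx.2.1⟩, Nat.mod_lt _ hn, hx.2.2⟩
  · simp only [mem_filter, mem_range, Prod.mk.injEq] at hx hy hxy
    exact Nat.ModEq.eq_of_lt_of_lt ((Nat.modEq_and_modEq_iff_modEq_mul h).1 hxy) hx.1 hy.1
  · rintro ⟨a, b⟩ hab
    simp only [mem_filter, mem_range, mem_product] at hab
    obtain ⟨⟨ha, hpa⟩, hb, hqb⟩ := hab
    obtain ⟨x, hxa, hxb⟩ := Nat.chineseRemainder h a b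
    have hma : x % (m * n) % m = a := by
      rw [Nat.mod_mul_right_mod, hxa, Nat.mod_eq_of_lt ha]
    have hnb : x % (m * n) % n = b := by
      rw [Nat.mod_mul_left_mod, hxb, Nat.mod_eq_of_lt hb]
    refine ⟨x % (m * n), ?_, Prod.ext hma hnb⟩
    rw [mem_filter, mem_range, ← hp.map_mod_nat, ← hq.map_mod_nat, hma, hnb]
    exact ⟨Nat.mod_lt _ (Nat.mul_pos hm hn), hpa, hqb⟩

lemma card_filter_Ico_add_mul_of_periodic {p : ℕ → Prop} [DecidablePred p] {d : ℕ}
    (hp : Periodic p d) (a q : ℕ) :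
    #{x ∈ Ico a (a + q * d) | p x} = q * #{x ∈ range d | p x} := by
  induction q with
  | zero => simp
  | succ q ih =>
    rw [Nat.succ_mul, ← add_assoc, ← Ico_union_Ico_eq_Ico (Nat.le_add_right _ _)
      (Nat.le_add_right _ _), filter_union, card_union_of_disjoint
      (disjoint_filter_filter (Ico_disjoint_Ico_consecutive _ _ _)), ih,
      Nat.filter_Ico_card_eq_of_periodic _ _ _ hp, Nat.count_eq_card_filter_range, Nat.succ_mul]

/-- Both terms of the difference lie between `⌊M / d⌋` and `⌊M / d⌋ + 1` times the number of
solutions in one period. -/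
lemma abs_card_filter_Ico_sub_le_of_periodic {p : ℕ → Prop} [DecidablePred p] {d : ℕ} (hd : 0 < d)
    (hp : Periodic p d) (a M : ℕ) :
    |(#{x ∈ Ico a (a + M) | p x} : ℝ) - M * (#{x ∈ range d | p x} / d)| ≤
      #{x ∈ range d | p x} := by
  set c := #{x ∈ range d | p x}
  have hd' : (0 : ℝ) < d := by exact_mod_cast hd
  have lower : M / d * c ≤ #{x ∈ Ico a (a + M) | p x} := by
    rw [← card_filter_Ico_add_mul_of_periodic hp a]
    gcongr
    exact Nat.div_mul_le_self M d
  have upper : #{x ∈ Ico a (a + M) | p x} ≤ (M / d + 1) * c := by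
    rw [← card_filter_Ico_add_mul_of_periodic hp a]
    gcongr
    exact (Nat.lt_div_mul_add hd).le.trans_eq (Nat.succ_mul _ _).symm
  have lower' : ((M / d : ℕ) : ℝ) * c ≤ M * (c / d) :=
    calc _ ≤ (M / d : ℝ) * c := by gcongr; exact Nat.cast_div_le
      _ = _ := by ring
  have upper' : M * (c / d) ≤ ((M / d : ℕ) + 1 : ℝ) * c :=
    calc (M : ℝ) * (c / d) = M / d * c := by ring
      _ ≤ _ := by
        gcongr
        rw [div_le_iff₀ hd']
        exact_mod_cast (Nat.lt_div_mul_add hd).le.trans_eq (Nat.succ_mul _ _).symm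
  have lower_cast : ((M / d : ℕ) : ℝ) * c ≤ #{x ∈ Ico a (a + M) | p x} := by exact_mod_cast lower
  have upper_cast : (#{x ∈ Ico a (a + M) | p x} : ℝ) ≤ ((M / d : ℕ) + 1 : ℝ) * c := by
    exact_mod_cast upper
  rw [abs_le]
  constructor <;> linarith

lemma periodic_dvd_add {p d : ℕ} (h : p ∣ d) (H : Finset ℕ) :
    Periodic (fun x => ∃ a ∈ H, p ∣ x + a) d := fun x => by
  simp only [add_right_comm x d, Nat.dvd_add_left h]

lemma periodic_forall_dvd_add {T : Finset ℕ} {d : ℕ} (h : ∀ p ∈ T, p ∣ d) (H : Finset ℕ) :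
    Periodic (fun x => ∀ p ∈ T, ∃ a ∈ H, p ∣ x + a) d := fun x =>
  propext <| forall₂_congr fun p hp => iff_of_eq (periodic_dvd_add (h p hp) H x)

lemma card_filter_range_exists_dvd_add {p : ℕ} [NeZero p] {H : Finset ℕ}
    (hH : Set.InjOn (fun h : ℕ => (h : ZMod p)) H) :
    #{x ∈ range p | ∃ h ∈ H, p ∣ x + h} = #H := by
  symm
  refine card_bij (fun h _ => (-(h : ZMod p)).val) (fun h hh => ?_) (fun a ha b hb hab => ?_)
    fun x hx => ?_
  · simp only [mem_filter, mem_range]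
    exact ⟨ZMod.val_lt _, h, hh, by simp [← ZMod.natCast_eq_zero_iff]⟩
  · exact hH ha hb (neg_injective (ZMod.val_injective p hab))
  · simp only [mem_filter, mem_range] at hx
    obtain ⟨hx, h, hh, hd⟩ := hx
    rw [← ZMod.natCast_eq_zero_iff, Nat.cast_add] at hd
    refine ⟨h, hh, ?_⟩
    rw [← eq_neg_iff_add_eq_zero.2 hd, ZMod.val_natCast, Nat.mod_eq_of_lt hx]

lemma card_filter_range_prod {T H : Finset ℕ} (hT : ∀ p ∈ T, p.Prime)
    (hH : ∀ p ∈ T, Set.InjOn (fun h : ℕ => (h : ZMod p)) H) :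
    #{x ∈ range (∏ p ∈ T, p) | ∀ p ∈ T, ∃ h ∈ H, p ∣ x + h} = #H ^ #T := by
  induction T using Finset.induction_on with
  | empty => simp
  | insert q T hq ih =>
    simp only [forall_mem_insert] at hT hH ⊢
    have : NeZero q := ⟨hT.1.ne_zero⟩
    have coprime : q.Coprime (∏ p ∈ T, p) := Nat.Coprime.prod_right fun p hp =>
      (Nat.coprime_primes hT.1 (hT.2 p hp)).2 (ne_of_mem_of_not_mem hp hq).symm
    rw [prod_insert hq, card_insert_of_notMem hq,
      card_filter_range_mul_of_coprime hT.1.pos (prod_pos fun p hp => (hT.2 p hp).pos) coprime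
        (periodic_dvd_add dvd_rfl H) (periodic_forall_dvd_add (fun p => dvd_prod_of_mem _) H),
      card_filter_range_exists_dvd_add hH.1, ih hT.2 hH.2, pow_succ']

theorem card_filter_Ico_not_dvd_add_le (a M : ℕ) {P H : Finset ℕ} (hP : ∀ p ∈ P, p.Prime)
    (hH : ∀ p ∈ P, Set.InjOn (fun h : ℕ => (h : ZMod p)) H) {z : ℝ} (hz : 1 ≤ z) {r : ℕ}
    (hr : Even r) :
    (#{n ∈ Ico a (a + M) | ∀ p ∈ P, ∀ h ∈ H, ¬ p ∣ n + h} : ℝ) ≤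
      M * (∏ p ∈ P, (1 - (#H : ℝ) / p) + (z ^ r)⁻¹ * ∏ p ∈ P, (1 + z * ((#H : ℝ) / p)))
        + (1 + #H * #P : ℝ) ^ r := by
  have count_le (T : Finset ℕ) (hT : T ⊆ P) :
      |(#{n ∈ Ico a (a + M) | ∀ p ∈ T, ∃ h ∈ H, p ∣ n + h} : ℝ) - M * ∏ p ∈ T, (#H : ℝ) / p| ≤
        (#H : ℝ) ^ #T := by
    have := abs_card_filter_Ico_sub_le_of_periodic (prod_pos fun p hp => (hP p (hT hp)).pos)
      (periodic_forall_dvd_add (fun p => dvd_prod_of_mem _) H) a M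
    rw [card_filter_range_prod (fun p hp => hP p (hT hp)) fun p hp => hH p (hT hp)] at this
    simpa only [prod_div_distrib, prod_const, Nat.cast_pow, Nat.cast_prod] using this
  have sieve := brun_pure_sieve (Ico a (a + M)) (b := fun p n => ∃ h ∈ H, p ∣ n + h)
    M.cast_nonneg (#H).cast_nonneg hz (fun p _ => by positivity) count_le hr
  simpa only [not_exists, not_and] using sieve

end CongruenceConditions

section Mertens

open Real

lemma sum_inv_primesLE_two_mul_sdiff_le {N : ℕ} (hN : 2 ≤ N) :
    ∑ p ∈ Nat.primesLE (2 * N) \ Nat.primesLE N, (1 / p : ℝ) ≤ 2 * log 4 / log N := by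
  have hN0 : (0 : ℝ) < N := by positivity
  have hlog : 0 < log N := log_pos (by exact_mod_cast hN)
  calc ∑ p ∈ Nat.primesLE (2 * N) \ Nat.primesLE N, (1 / p : ℝ)
      ≤ ∑ p ∈ Nat.primesLE (2 * N) \ Nat.primesLE N, log p / (N * log N) := by
        refine sum_le_sum fun p hp => ?_
        simp only [mem_sdiff, Nat.mem_primesLE] at hp
        have hNp : (N : ℝ) ≤ p := by
          exact_mod_cast (not_le.1 fun h => hp.2 ⟨h, hp.1.2⟩ : N < p).le
        rw [div_le_div_iff₀ (hN0.trans_le hNp) (by positivity), one_mul, mul_comm]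
        gcongr
    _ ≤ ∑ p ∈ Nat.primesLE (2 * N), log p / (N * log N) :=
        sum_le_sum_of_subset_of_nonneg sdiff_subset fun p _ _ =>
          div_nonneg (log_natCast_nonneg p) (by positivity)
    _ = Chebyshev.theta (2 * N : ℕ) / (N * log N) := by
        rw [← sum_div, Chebyshev.theta_eq_sum_primesLE_log]
    _ ≤ log 4 * (2 * N : ℕ) / (N * log N) := by
        gcongr
        exact Chebyshev.theta_le_log4_mul_x (Nat.cast_nonneg _)
    _ = 2 * log 4 / log N := by
        push_cast
        field_simp

lemma log_four_eq : log 4 = 2 * log 2 := by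
  rw [show (4 : ℝ) = 2 ^ 2 by norm_num, log_pow, Nat.cast_ofNat]

lemma sum_inv_primesLE_two_pow_le (J : ℕ) :
    ∑ p ∈ Nat.primesLE (2 ^ (J + 1)), (1 / p : ℝ) ≤ 1 + 4 * harmonic J := by
  induction J with
  | zero =>
    have : Nat.primesLE (2 ^ (0 + 1)) = {2} := by decide
    rw [this]
    norm_num
  | succ J ih =>
    have subset : Nat.primesLE (2 ^ (J + 1)) ⊆ Nat.primesLE (2 * 2 ^ (J + 1)) := fun p hp => by
      rw [Nat.mem_primesLE] at hp ⊢
      exact ⟨by lia, hp.2⟩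
    have block := sum_inv_primesLE_two_mul_sdiff_le (N := 2 ^ (J + 1))
      (Nat.le_self_pow J.succ_ne_zero 2)
    have : 0 < log 2 := log_pos one_lt_two
    have block_eq : 2 * log 4 / log ((2 ^ (J + 1) : ℕ) : ℝ) = 4 * ((J : ℝ) + 1)⁻¹ := by
      push_cast
      rw [log_four_eq, log_pow]
      push_cast
      field_simp
      ring
    rw [pow_succ' 2 (J + 1), ← sum_sdiff subset, harmonic_succ]
    push_cast
    linarith

lemma one_le_log_of_three_le {x : ℝ} (hx : 3 ≤ x) : 1 ≤ log x := by
  rw [le_log_iff_exp_le (by linarith)]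
  exact exp_one_lt_three.le.trans hx

lemma sum_inv_primesLE_le {y : ℝ} (hy : 3 ≤ y) :
    ∑ p ∈ Nat.primesLE ⌊y⌋₊, (1 / p : ℝ) ≤ 9 + 4 * log (log y) := by
  have log_two_pos : 0 < log 2 := log_pos one_lt_two
  have one_le_log : 1 ≤ log y := one_le_log_of_three_le hy
  set J := ⌊log y / log 2⌋₊
  have J_pos : 0 < J := by
    rw [Nat.floor_pos, one_le_div log_two_pos]
    exact log_le_log two_pos (by linarith)
  have floor_le : ⌊y⌋₊ ≤ 2 ^ (J + 1) := by
    refine Nat.floor_le_of_le ?_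
    rw [← log_le_log_iff (by linarith) (by positivity)]
    push_cast
    rw [log_pow, ← div_le_iff₀ log_two_pos]
    exact_mod_cast (Nat.lt_floor_add_one (log y / log 2)).le
  have log_J_le : log J ≤ 1 + log (log y) := by
    have J_le : (J : ℝ) ≤ exp 1 * log y :=
      calc (J : ℝ) ≤ log y / log 2 := Nat.floor_le (by positivity)
        _ = (1 / log 2) * log y := by ring
        _ ≤ exp 1 * log y := by
          gcongr
          rw [div_le_iff₀ log_two_pos]
          nlinarith [exp_one_gt_d9, log_two_gt_d9]
    calc log J ≤ log (exp 1 * log y) := log_le_log (by positivity) J_le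
      _ = _ := by rw [log_mul (exp_pos _).ne' (by positivity), log_exp]
  calc ∑ p ∈ Nat.primesLE ⌊y⌋₊, (1 / p : ℝ)
      ≤ ∑ p ∈ Nat.primesLE (2 ^ (J + 1)), (1 / p : ℝ) := by
        refine sum_le_sum_of_subset_of_nonneg (fun p hp => ?_) fun p _ _ => by positivity
        rw [Nat.mem_primesLE] at hp ⊢
        exact ⟨hp.1.trans floor_le, hp.2⟩
    _ ≤ 1 + 4 * harmonic J := sum_inv_primesLE_two_pow_le J
    _ ≤ 1 + 4 * (1 + log J) := by gcongr; exact harmonic_le_one_add_log J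
    _ ≤ _ := by linarith

lemma one_sub_inv_pos {p : ℕ} (hp : p.Prime) : (0 : ℝ) < 1 - 1 / p := by
  rw [sub_pos, one_div]
  exact inv_lt_one_of_one_lt₀ (by exact_mod_cast hp.one_lt)

lemma harmonic_le_prod_primesLE (N : ℕ) :
    (harmonic N : ℝ) ≤ ∏ p ∈ Nat.primesLE N, (1 - 1 / p : ℝ)⁻¹ := by
  let f : ℕ →* ℝ :=
    (invMonoidWithZeroHom : ℝ →*₀ ℝ).toMonoidHom.comp (Nat.castRingHom ℝ).toMonoidHom
  have f_apply (n : ℕ) : f n = (n : ℝ)⁻¹ := rfl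
  have norm_f_lt_one {p : ℕ} (hp : p.Prime) : ‖f p‖ < 1 := by
    rw [f_apply, norm_inv, norm_natCast]
    exact inv_lt_one_of_one_lt₀ (by exact_mod_cast hp.one_lt)
  have euler := (EulerProduct.summable_and_hasSum_smoothNumbers_prod_primesBelow_geometric
    norm_f_lt_one (N + 1)).2
  have mem_smooth : ∀ n ∈ Icc 1 N, n ∈ (N + 1).smoothNumbers := fun n hn => by
    rw [mem_Icc] at hn
    exact Nat.mem_smoothNumbers_of_lt hn.1 (Nat.lt_succ_of_le hn.2)
  have partial_le := sum_le_hasSum ((Icc 1 N).subtype (· ∈ (N + 1).smoothNumbers))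
    (fun i _ => by rw [f_apply]; positivity) euler
  rw [sum_subtype_eq_sum_filter (f := f), filter_true_of_mem mem_smooth] at partial_le
  rw [harmonic_eq_sum_Icc]
  push_cast
  simp only [one_div]
  exact partial_le

lemma prod_one_sub_inv_primesLE_le {y : ℝ} (hy : 1 < y) :
    ∏ p ∈ Nat.primesLE ⌊y⌋₊, (1 - 1 / p : ℝ) ≤ 1 / log y := by
  have prod_pos : (0 : ℝ) < ∏ p ∈ Nat.primesLE ⌊y⌋₊, (1 - 1 / p : ℝ) :=
    prod_pos fun p hp => one_sub_inv_pos (Nat.prime_of_mem_primesLE hp)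
  rw [le_one_div prod_pos (log_pos hy), one_div, ← prod_inv_distrib]
  exact (log_le_harmonic_floor y (by linarith)).trans (harmonic_le_prod_primesLE _)

lemma card_primeFactors_le_log {D : ℕ} (hD : D ≠ 0) :
    (#D.primeFactors : ℝ) ≤ log D / log 2 := by
  have two_pow_le : 2 ^ #D.primeFactors ≤ D :=
    (pow_card_le_prod _ _ _ fun p hp => (Nat.prime_of_mem_primeFactors hp).two_le).trans
      (Nat.le_of_dvd (Nat.pos_of_ne_zero hD) (Nat.prod_primeFactors_dvd D))
  rw [le_div_iff₀ (log_pos one_lt_two), ← log_pow]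
  exact log_le_log (by positivity) (by exact_mod_cast two_pow_le)

lemma sum_inv_primeFactors_le {D : ℕ} (hD : D ≠ 0) {w : ℝ} (hw : 3 ≤ w) :
    ∑ p ∈ D.primeFactors, (1 / p : ℝ) ≤ 9 + 4 * log (log w) + log D / log 2 / w := by
  have small : ∑ p ∈ D.primeFactors with p ≤ ⌊w⌋₊, (1 / p : ℝ) ≤ 9 + 4 * log (log w) := by
    refine (sum_le_sum_of_subset_of_nonneg (fun p hp => ?_) fun p _ _ => by positivity).trans
      (sum_inv_primesLE_le hw)
    rw [mem_filter] at hp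
    exact Nat.mem_primesLE.2 ⟨hp.2, Nat.prime_of_mem_primeFactors hp.1⟩
  have large : ∑ p ∈ D.primeFactors with ¬ p ≤ ⌊w⌋₊, (1 / p : ℝ) ≤ log D / log 2 / w :=
    calc _ ≤ ∑ p ∈ D.primeFactors with ¬ p ≤ ⌊w⌋₊, 1 / w := by
          refine sum_le_sum fun p hp => ?_
          rw [mem_filter, not_le, Nat.floor_lt (by linarith)] at hp
          exact one_div_le_one_div_of_le (by linarith) hp.2.le
      _ ≤ ∑ p ∈ D.primeFactors, 1 / w :=
          sum_le_sum_of_subset_of_nonneg (filter_subset _ _) fun p _ _ => by positivity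
      _ = #D.primeFactors / w := by rw [sum_const, nsmul_eq_mul, mul_one_div]
      _ ≤ _ := by gcongr; exact card_primeFactors_le_log hD
  rw [← sum_filter_add_sum_filter_not D.primeFactors (· ≤ ⌊w⌋₊)]
  exact add_le_add small large

lemma one_le_exp_two_mul_mul_one_sub {x : ℝ} (h0 : 0 ≤ x) (hx : x ≤ 1 / 2) :
    1 ≤ exp (2 * x) * (1 - x) := by
  nlinarith [add_one_le_exp (2 * x)]

lemma prod_one_sub_inv_filter_not_dvd_le {D : ℕ} (hD : D ≠ 0) {y : ℝ} (hy : 1 < y) :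
    ∏ p ∈ Nat.primesLE ⌊y⌋₊ with ¬ p ∣ D, (1 - 1 / p : ℝ) ≤
      exp (2 * ∑ p ∈ D.primeFactors, (1 / p : ℝ)) / log y := by
  set Q := Nat.primesLE ⌊y⌋₊
  have prod_nonneg_filter (s : ℕ → Prop) [DecidablePred s] :
      0 ≤ ∏ p ∈ Q with s p, (1 - 1 / p : ℝ) :=
    prod_nonneg fun p hp => (one_sub_inv_pos (Nat.prime_of_mem_primesLE (mem_filter.1 hp).1)).le
  have sum_le : ∑ p ∈ Q with p ∣ D, (1 / p : ℝ) ≤ ∑ p ∈ D.primeFactors, (1 / p : ℝ) := by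
    refine sum_le_sum_of_subset_of_nonneg (fun p hp => ?_) fun p _ _ => by positivity
    rw [mem_filter] at hp
    exact Nat.mem_primeFactors.2 ⟨Nat.prime_of_mem_primesLE hp.1, hp.2, hD⟩
  have dividing : 1 ≤ exp (2 * ∑ p ∈ D.primeFactors, (1 / p : ℝ)) *
      ∏ p ∈ Q with p ∣ D, (1 - 1 / p : ℝ) :=
    calc (1 : ℝ) ≤ ∏ p ∈ Q with p ∣ D, (exp (2 * (1 / p)) * (1 - 1 / p : ℝ)) := by
          refine one_le_prod fun p hp => one_le_exp_two_mul_mul_one_sub (by positivity) ?_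
          have two_le := (Nat.prime_of_mem_primesLE (mem_filter.1 hp).1).two_le
          exact one_div_le_one_div_of_le two_pos (by exact_mod_cast two_le)
      _ = exp (2 * ∑ p ∈ Q with p ∣ D, (1 / p : ℝ)) * ∏ p ∈ Q with p ∣ D, (1 - 1 / p : ℝ) := by
          rw [prod_mul_distrib, ← exp_sum, mul_sum]
      _ ≤ _ := by
          gcongr
          exact prod_nonneg_filter _
  calc ∏ p ∈ Q with ¬ p ∣ D, (1 - 1 / p : ℝ)
      ≤ (exp (2 * ∑ p ∈ D.primeFactors, (1 / p : ℝ)) * ∏ p ∈ Q with p ∣ D, (1 - 1 / p : ℝ)) *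
        ∏ p ∈ Q with ¬ p ∣ D, (1 - 1 / p : ℝ) :=
        le_mul_of_one_le_left (prod_nonneg_filter _) dividing
    _ = exp (2 * ∑ p ∈ D.primeFactors, (1 / p : ℝ)) * ∏ p ∈ Q, (1 - 1 / p : ℝ) := by
        rw [mul_assoc, prod_filter_mul_prod_filter_not]
    _ ≤ exp (2 * ∑ p ∈ D.primeFactors, (1 / p : ℝ)) * (1 / log y) := by
        gcongr
        exact prod_one_sub_inv_primesLE_le hy
    _ = _ := mul_one_div _ _

lemma prod_one_sub_div_filter_not_dvd_le {D k : ℕ} (hD : D ≠ 0)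
    (hkD : ∀ p : ℕ, p.Prime → p ≤ k → p ∣ D) {y : ℝ} (hy : 1 < y) :
    ∏ p ∈ Nat.primesLE ⌊y⌋₊ with ¬ p ∣ D, (1 - k / p : ℝ) ≤
      (exp (2 * ∑ p ∈ D.primeFactors, (1 / p : ℝ)) / log y) ^ k := by
  have factor_nonneg {p : ℕ} (hp : p.Prime) (hpD : ¬ p ∣ D) : 0 ≤ (1 - k / p : ℝ) := by
    rw [sub_nonneg, div_le_one (by exact_mod_cast hp.pos)]
    exact_mod_cast (not_le.1 (mt (hkD p hp) hpD)).le
  have bernoulli {p : ℕ} (hp : p.Prime) : (1 - k / p : ℝ) ≤ (1 - 1 / p) ^ k :=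
    calc (1 - k / p : ℝ) = 1 + k * (-(1 / p)) := by ring
      _ ≤ (1 + -(1 / p)) ^ k := one_add_mul_le_pow (by linarith [one_sub_inv_pos hp]) k
      _ = _ := by ring
  calc ∏ p ∈ Nat.primesLE ⌊y⌋₊ with ¬ p ∣ D, (1 - k / p : ℝ)
      ≤ ∏ p ∈ Nat.primesLE ⌊y⌋₊ with ¬ p ∣ D, (1 - 1 / p : ℝ) ^ k := by
        refine prod_le_prod (fun p hp => ?_) fun p hp => ?_
        all_goals rw [mem_filter, Nat.mem_primesLE] at hp
        · exact factor_nonneg hp.1.2 hp.2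
        · exact bernoulli hp.1.2
    _ = (∏ p ∈ Nat.primesLE ⌊y⌋₊ with ¬ p ∣ D, (1 - 1 / p : ℝ)) ^ k := prod_pow _ _ _
    _ ≤ _ := by
        gcongr
        · exact prod_nonneg fun p hp =>
            (one_sub_inv_pos (Nat.prime_of_mem_primesLE (mem_filter.1 hp).1)).le
        · exact prod_one_sub_inv_filter_not_dvd_le hD hy

end Mertens

section PrimeTuples

open Real

/-- A nonzero number attached to a set `H` of shifts, divisible by every prime `p ≤ #H` and by
every prime modulo which two elements of `H` coincide; the sieve leaves its prime factors out. -/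
def tupleModulus (H : Finset ℕ) : ℕ := (#H).factorial * ∏ q ∈ H.offDiag, Nat.dist q.1 q.2

lemma tupleModulus_ne_zero (H : Finset ℕ) : tupleModulus H ≠ 0 := by
  refine mul_ne_zero (Nat.factorial_ne_zero _) (prod_ne_zero_iff.2 fun q hq => ?_)
  exact (Nat.dist_pos_of_ne (mem_offDiag.1 hq).2.2).ne'

lemma dvd_tupleModulus_of_prime_of_le_card {H : Finset ℕ} {p : ℕ} (hp : p.Prime) (hpH : p ≤ #H) :
    p ∣ tupleModulus H :=
  (hp.dvd_factorial.2 hpH).mul_right _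

lemma dvd_dist_of_natCast_eq {p a b : ℕ} (h : (a : ZMod p) = b) :
    p ∣ Nat.dist a b := by
  rw [Nat.dist, ← ZMod.natCast_eq_zero_iff]
  rcases le_total a b with hab | hab <;>
    simp only [Nat.sub_eq_zero_of_le hab, zero_add, add_zero, Nat.cast_sub hab, h, sub_self]

lemma injOn_natCast_of_not_dvd_tupleModulus {H : Finset ℕ} {p : ℕ} (hp : ¬ p ∣ tupleModulus H) :
    Set.InjOn (fun h : ℕ => (h : ZMod p)) H := by
  intro a ha b hb hab
  by_contra hne
  have dist_dvd : Nat.dist a b ∣ ∏ q ∈ H.offDiag, Nat.dist q.1 q.2 :=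
    dvd_prod_of_mem (fun q : ℕ × ℕ => Nat.dist q.1 q.2)
      (mem_offDiag.2 ⟨ha, hb, hne⟩ : (a, b) ∈ H.offDiag)
  exact hp (((dvd_dist_of_natCast_eq hab).trans dist_dvd).mul_left _)

lemma log_tupleModulus_le {H : Finset ℕ} {Y : ℝ} (hY : 1 ≤ Y) (hH : ∀ h ∈ H, (h : ℝ) ≤ Y) :
    log (tupleModulus H) ≤ log (#H).factorial + (#H : ℝ) ^ 2 * log Y := by
  have dist_le {q : ℕ × ℕ} (hq : q ∈ H.offDiag) : (Nat.dist q.1 q.2 : ℝ) ≤ Y := by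
    rw [mem_offDiag] at hq
    have dist_le_max : Nat.dist q.1 q.2 ≤ max q.1 q.2 := by unfold Nat.dist; lia
    refine (Nat.cast_le.2 dist_le_max).trans ?_
    rw [Nat.cast_max]
    exact max_le (hH _ hq.1) (hH _ hq.2.1)
  have prod_le : (∏ q ∈ H.offDiag, Nat.dist q.1 q.2 : ℝ) ≤ Y ^ #H ^ 2 :=
    calc (∏ q ∈ H.offDiag, Nat.dist q.1 q.2 : ℝ) ≤ ∏ _q ∈ H.offDiag, Y :=
          prod_le_prod (fun _ _ => Nat.cast_nonneg _) fun _ => dist_le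
      _ = Y ^ #H.offDiag := prod_const _
      _ ≤ Y ^ #H ^ 2 := by
          refine pow_le_pow_right₀ hY ?_
          rw [offDiag_card, sq]
          exact Nat.sub_le _ _
  have tupleModulus_pos : (0 : ℝ) < tupleModulus H :=
    by exact_mod_cast Nat.pos_of_ne_zero (tupleModulus_ne_zero H)
  calc log (tupleModulus H) ≤ log ((#H).factorial * Y ^ #H ^ 2) := by
        refine log_le_log tupleModulus_pos ?_
        rw [tupleModulus]
        push_cast
        gcongr
    _ = _ := by
        rw [log_mul (by positivity) (by positivity), log_pow]
        push_cast
        rfl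

/-- The primes up to `y` used to sift translates by `H`: modulo each of them, the shifts occupy
`#H < p` distinct residue classes. -/
noncomputable def siftingPrimes (H : Finset ℕ) (y : ℝ) : Finset ℕ :=
  {p ∈ Nat.primesLE ⌊y⌋₊ | ¬ p ∣ tupleModulus H}

lemma prime_of_mem_siftingPrimes {H : Finset ℕ} {y : ℝ} {p : ℕ} (hp : p ∈ siftingPrimes H y) :
    p.Prime :=
  Nat.prime_of_mem_primesLE (mem_filter.1 hp).1

lemma le_of_mem_siftingPrimes {H : Finset ℕ} {y : ℝ} {p : ℕ} (hp : p ∈ siftingPrimes H y) :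
    (p : ℝ) ≤ y :=
  (Nat.le_floor_iff' (prime_of_mem_siftingPrimes hp).ne_zero).1
    (Nat.mem_primesLE.1 (mem_filter.1 hp).1).1

theorem card_prime_translates_le (H : Finset ℕ) {a : ℕ} {y : ℝ} (hya : y < a) (M : ℕ) {z : ℝ}
    (hz : 1 ≤ z) {r : ℕ} (hr : Even r) :
    (#{n ∈ Ico a (a + M) | ∀ h ∈ H, (n + h).Prime} : ℝ) ≤
      M * (∏ p ∈ siftingPrimes H y, (1 - (#H : ℝ) / p)
        + (z ^ r)⁻¹ * ∏ p ∈ siftingPrimes H y, (1 + z * ((#H : ℝ) / p)))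
        + (1 + #H * #(siftingPrimes H y) : ℝ) ^ r := by
  have survives : {n ∈ Ico a (a + M) | ∀ h ∈ H, (n + h).Prime} ⊆
      {n ∈ Ico a (a + M) | ∀ p ∈ siftingPrimes H y, ∀ h ∈ H, ¬ p ∣ n + h} := by
    intro n hn
    rw [mem_filter] at hn ⊢
    refine ⟨hn.1, fun p hp h hh hdvd => ?_⟩
    have p_eq : p = n + h :=
      (Nat.prime_dvd_prime_iff_eq (prime_of_mem_siftingPrimes hp) (hn.2 h hh)).1 hdvd
    have a_le_p : (a : ℝ) ≤ p := by
      exact_mod_cast p_eq ▸ (mem_Ico.1 hn.1).1.trans (Nat.le_add_right n h)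
    exact (hya.trans_le a_le_p).not_ge (le_of_mem_siftingPrimes hp)
  refine (Nat.cast_le.2 (card_le_card survives)).trans (card_filter_Ico_not_dvd_add_le a M
    (fun p => prime_of_mem_siftingPrimes) (fun p hp => ?_) hz hr)
  exact injOn_natCast_of_not_dvd_tupleModulus (mem_filter.1 hp).2

end PrimeTuples

section SieveParameters

open Real Filter

/-- The sieving level `X ^ (1 / ((56 k + 8) log log X))` for `k` translates: the constant makes the
Brun remainder, a power of the level with exponent `2 * sieveOrder k X`, at most `√X`. -/
noncomputable def sieveLevel (k : ℕ) (X : ℝ) : ℝ :=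
  exp (log X / ((56 * k + 8) * log (log X)))

/-- The truncation order of the Brun sieve for `k` translates: an even number, at least
`14 k log log X` so that the truncation error saves more than `(log X) ^ k`. -/
noncomputable def sieveOrder (k : ℕ) (X : ℝ) : ℕ := 2 * ⌈7 * k * log (log X)⌉₊

lemma even_sieveOrder (k : ℕ) (X : ℝ) : Even (sieveOrder k X) := even_two_mul _

lemma le_sieveOrder (k : ℕ) (X : ℝ) : 14 * k * log (log X) ≤ sieveOrder k X := by
  rw [sieveOrder]
  push_cast
  linarith [Nat.le_ceil (7 * k * log (log X))]

lemma sieveOrder_le (k : ℕ) {X : ℝ} (hX : 3 ≤ log X) :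
    (sieveOrder k X : ℝ) ≤ (14 * k + 2) * log (log X) := by
  have one_le := one_le_log_of_three_le hX
  have ceil_lt := Nat.ceil_lt_add_one (show 0 ≤ 7 * k * log (log X) by positivity)
  rw [sieveOrder]
  push_cast
  linarith

lemma sieveLevel_lt (k : ℕ) {X : ℝ} (hX : 0 < X) (hlog : 3 ≤ log X) : sieveLevel k X < X := by
  have one_le := one_le_log_of_three_le hlog
  rw [sieveLevel, ← lt_log_iff_exp_lt hX]
  refine div_lt_self (by linarith) (one_lt_mul_of_lt_of_le ?_ one_le)
  linarith [k.cast_nonneg (α := ℝ)]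

lemma tendsto_sieveLevel_atTop (k : ℕ) : Tendsto (sieveLevel k) atTop atTop := by
  have tendsto_div_log : Tendsto (fun L => (56 * k + 8 : ℝ)⁻¹ * (L / log L)) atTop atTop := by
    refine Tendsto.const_mul_atTop (by positivity) ?_
    refine ((tendsto_exp_div_pow_atTop 1).comp tendsto_log_atTop).congr' ?_
    filter_upwards [eventually_gt_atTop 0] with L hL
    simp only [Function.comp_apply, exp_log hL, pow_one]
  refine tendsto_exp_atTop.comp ((tendsto_div_log.comp tendsto_log_atTop).congr fun X => ?_)
  simp only [Function.comp_apply]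
  rw [inv_mul_eq_div, div_div, mul_comm (log (log X))]

lemma prod_siftingPrimes_sieveLevel_le {H : Finset ℕ} {X E : ℝ} (hX : 3 ≤ log X)
    (hE : log (tupleModulus H) ≤ E * log X) :
    ∏ p ∈ siftingPrimes H (sieveLevel #H X), (1 - (#H : ℝ) / p) ≤
      (exp (2 * (9 + E / log 2)) * (56 * #H + 8)) ^ #H *
        (log (log X) ^ (9 * #H) / log X ^ #H) := by
  have : 0 < log 2 := log_pos one_lt_two
  have one_le := one_le_log_of_three_le hX
  have sum_le : ∑ p ∈ (tupleModulus H).primeFactors, (1 / p : ℝ) ≤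
      9 + E / log 2 + 4 * log (log (log X)) :=
    calc _ ≤ 9 + 4 * log (log (log X)) + log (tupleModulus H) / log 2 / log X :=
          sum_inv_primeFactors_le (tupleModulus_ne_zero H) hX
      _ ≤ 9 + 4 * log (log (log X)) + E * log X / log 2 / log X := by gcongr
      _ = _ := by
          field_simp
          ring
  have exp_sum_le : exp (2 * ∑ p ∈ (tupleModulus H).primeFactors, (1 / p : ℝ)) ≤
      exp (2 * (9 + E / log 2)) * log (log X) ^ 8 :=
    calc _ ≤ exp (2 * (9 + E / log 2) + (8 : ℕ) * log (log (log X))) := by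
          gcongr
          push_cast
          linarith
      _ = _ := by rw [exp_add, exp_nat_mul, exp_log (by positivity)]
  calc _ ≤ (exp (2 * ∑ p ∈ (tupleModulus H).primeFactors, (1 / p : ℝ)) /
          log (sieveLevel #H X)) ^ #H :=
        prod_one_sub_div_filter_not_dvd_le (tupleModulus_ne_zero H)
          (fun _ => dvd_tupleModulus_of_prime_of_le_card) (one_lt_exp_iff.2 (by positivity))
    _ ≤ (exp (2 * (9 + E / log 2)) * log (log X) ^ 8 /
          (log X / ((56 * #H + 8) * log (log X)))) ^ #H := by
        rw [sieveLevel, log_exp]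
        gcongr
    _ = _ := by
        rw [pow_mul, ← div_pow, ← mul_pow]
        field_simp

lemma prod_one_add_mul_div_le {c y : ℝ} (hc : 0 ≤ c) (hy : 3 ≤ y) {P : Finset ℕ}
    (hP : P ⊆ Nat.primesLE ⌊y⌋₊) :
    ∏ p ∈ P, (1 + c * (1 / p : ℝ)) ≤ exp (c * (9 + 4 * log (log y))) :=
  calc ∏ p ∈ P, (1 + c * (1 / p : ℝ)) ≤ exp (∑ p ∈ P, c * (1 / p : ℝ)) :=
        prod_one_add_le_exp_sum P fun p => by positivity
    _ ≤ exp (c * (9 + 4 * log (log y))) := by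
        rw [← mul_sum]
        gcongr
        exact (sum_le_sum_of_subset_of_nonneg hP fun p _ _ => by positivity).trans
          (sum_inv_primesLE_le hy)

lemma rankin_tail_le (k : ℕ) {X y : ℝ} (hy : 3 ≤ y) (hyX : y ≤ X) {P : Finset ℕ}
    (hP : P ⊆ Nat.primesLE ⌊y⌋₊) {r : ℕ} (hr : 14 * k * log (log X) ≤ r) :
    (exp 1 ^ r)⁻¹ * ∏ p ∈ P, (1 + exp 1 * ((k : ℝ) / p)) ≤ exp (27 * k) / log X ^ k := by
  have one_le_log_y := one_le_log_of_three_le hy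
  have log_y_le : log y ≤ log X := log_le_log (by linarith) hyX
  have log_log_y_nonneg : 0 ≤ log (log y) := log_nonneg one_le_log_y
  have log_log_y_le : log (log y) ≤ log (log X) := log_le_log (by linarith) log_y_le
  have prod_le : ∏ p ∈ P, (1 + exp 1 * ((k : ℝ) / p)) ≤ exp (27 * k + 12 * k * log (log X)) :=
    calc _ = ∏ p ∈ P, (1 + exp 1 * k * (1 / p : ℝ)) :=
          prod_congr rfl fun p _ => by ring
      _ ≤ exp (exp 1 * k * (9 + 4 * log (log y))) :=
          prod_one_add_mul_div_le (by positivity) hy hP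
      _ ≤ exp (3 * k * (9 + 4 * log (log X))) := by
          gcongr
          exact exp_one_lt_three.le
      _ = _ := by ring_nf
  calc _ ≤ exp (-(14 * k * log (log X))) * exp (27 * k + 12 * k * log (log X)) := by
        rw [exp_one_pow, ← exp_neg]
        gcongr
    _ = exp (27 * k - 2 * (k * log (log X))) := by
        rw [← exp_add]
        ring_nf
    _ ≤ exp (27 * k - k * log (log X)) := by
        refine exp_le_exp.2 (sub_le_sub_left (le_mul_of_one_le_left ?_ one_le_two) _)
        exact mul_nonneg k.cast_nonneg (log_log_y_nonneg.trans log_log_y_le)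
    _ = _ := by rw [exp_sub, exp_nat_mul (log (log X)) k, exp_log (by linarith)]

lemma card_le_of_subset_primesLE_floor {P : Finset ℕ} {y : ℝ} (hy : 0 ≤ y)
    (hP : P ⊆ Nat.primesLE ⌊y⌋₊) : (#P : ℝ) ≤ y := by
  refine (Nat.le_floor_iff hy).1 ((card_le_card hP).trans ?_)
  rw [Nat.primesLE_eq_filter_Ioc_zero]
  exact (card_filter_le _ _).trans_eq (Nat.card_Ioc 0 _)

lemma brun_remainder_le {k : ℕ} {X : ℝ} (hX : 0 < X) (hlog : 3 ≤ log X)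
    (hlevel : k + 1 ≤ sieveLevel k X) (hpow : log X ^ (2 * k) ≤ X) {P : Finset ℕ}
    (hP : P ⊆ Nat.primesLE ⌊sieveLevel k X⌋₊) :
    (1 + k * #P : ℝ) ^ sieveOrder k X ≤ X / log X ^ k := by
  have one_le := one_le_log_of_three_le hlog
  set y := sieveLevel k X with hy
  have y_pos : 0 < y := exp_pos _
  have base_le : 1 + k * #P ≤ y ^ 2 :=
    calc 1 + k * #P ≤ 1 + k * y := by gcongr; exact card_le_of_subset_primesLE_floor y_pos.le hP
      _ ≤ y ^ 2 := by nlinarith [k.cast_nonneg (α := ℝ)]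
  have exponent_le : sieveOrder k X * (2 * (log X / ((56 * k + 8) * log (log X)))) ≤ log X / 2 :=
    calc _ ≤ (14 * k + 2) * log (log X) * (2 * (log X / ((56 * k + 8) * log (log X)))) := by
          gcongr
          exact sieveOrder_le k hlog
      _ = _ := by field
  have log_pow_le : log X ^ k ≤ exp (log X / 2) := by
    refine (sq_le_sq₀ (by positivity) (exp_pos _).le).1 ?_
    rwa [← pow_mul, mul_comm k, ← exp_nat_mul, Nat.cast_ofNat, mul_div_cancel₀ _ two_ne_zero,
      exp_log hX]
  calc (1 + k * #P : ℝ) ^ sieveOrder k X ≤ (y ^ 2) ^ sieveOrder k X := by gcongr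
    _ = exp (sieveOrder k X * (2 * (log X / ((56 * k + 8) * log (log X))))) := by
        rw [exp_nat_mul, hy, sieveLevel, ← exp_nat_mul, Nat.cast_ofNat]
    _ ≤ exp (log X / 2) := by gcongr
    _ ≤ X / log X ^ k := by
        rw [le_div_iff₀ (by positivity)]
        calc _ ≤ exp (log X / 2) * exp (log X / 2) := by gcongr
          _ = X := by rw [← exp_add, add_halves, exp_log hX]

lemma card_prime_translates_le_of_large {H : Finset ℕ} {X E : ℝ} (hX : 0 < X) (hlog : 3 ≤ log X)
    (hthree : 3 ≤ sieveLevel #H X) (hlevel : #H + 1 ≤ sieveLevel #H X)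
    (hpow : log X ^ (2 * #H) ≤ X) (hE : log (tupleModulus H) ≤ E * log X) {a M : ℕ} (ha : X ≤ a)
    (hM : M ≤ 2 * X) :
    (#{n ∈ Ico a (a + M) | ∀ h ∈ H, (n + h).Prime} : ℝ) ≤
      (2 * ((exp (2 * (9 + E / log 2)) * (56 * #H + 8)) ^ #H + exp (27 * #H)) + 1) *
        (X * (log (log X) ^ (9 * #H) / log X ^ #H)) := by
  set c := (exp (2 * (9 + E / log 2)) * (56 * #H + 8)) ^ #H
  set Z := log (log X) ^ (9 * #H) / log X ^ #H with hZ
  set P := siftingPrimes H (sieveLevel #H X)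
  have one_le := one_le_log_of_three_le hlog
  have Z_nonneg : 0 ≤ Z := by
    rw [hZ]
    positivity
  have div_le {b : ℝ} (hb : 0 ≤ b) : b / log X ^ #H ≤ b * Z := by
    rw [hZ, ← mul_div_assoc]
    gcongr
    exact le_mul_of_one_le_right hb (one_le_pow₀ one_le)
  have P_subset : P ⊆ Nat.primesLE ⌊sieveLevel #H X⌋₊ := filter_subset _ _
  have main : ∏ p ∈ P, (1 - (#H : ℝ) / p) ≤ c * Z := prod_siftingPrimes_sieveLevel_le hlog hE
  have tail := (rankin_tail_le #H hthree (sieveLevel_lt #H hX hlog).le P_subset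
    (le_sieveOrder #H X)).trans (div_le (exp_pos _).le)
  have remainder := (brun_remainder_le hX hlog hlevel hpow P_subset).trans (div_le hX.le)
  calc _ ≤ M * (∏ p ∈ P, (1 - (#H : ℝ) / p)
          + (exp 1 ^ sieveOrder #H X)⁻¹ * ∏ p ∈ P, (1 + exp 1 * ((#H : ℝ) / p)))
          + (1 + #H * #P : ℝ) ^ sieveOrder #H X :=
        card_prime_translates_le H ((sieveLevel_lt #H hX hlog).trans_le ha) M
          (one_le_exp zero_le_one) (even_sieveOrder #H X)
    _ ≤ M * (c * Z + exp (27 * #H) * Z) + X * Z := by gcongr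
    _ ≤ 2 * X * (c * Z + exp (27 * #H) * Z) + X * Z := by gcongr
    _ = _ := by ring

theorem exists_card_prime_translates_le (k m : ℕ) :
    ∃ C : ℝ, 0 < C ∧ ∀ᶠ X : ℝ in atTop, ∀ H : Finset ℕ, #H = k → (∀ h ∈ H, (h : ℝ) ≤ X ^ m) →
      ∀ a M : ℕ, X ≤ a → M ≤ 2 * X →
        (#{n ∈ Ico a (a + M) | ∀ h ∈ H, (n + h).Prime} : ℝ) ≤
          C * (X * (log (log X) ^ (9 * k) / log X ^ k)) := by
  set E : ℝ := k ^ 2 * m + 1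
  refine ⟨2 * ((exp (2 * (9 + E / log 2)) * (56 * k + 8)) ^ k + exp (27 * k)) + 1,
    by positivity, ?_⟩
  have eventually_pow_le : ∀ᶠ X : ℝ in atTop, log X ^ (2 * k) ≤ X := by
    filter_upwards [(isLittleO_pow_log_id_atTop (n := 2 * k)).bound one_pos,
      eventually_ge_atTop 0] with X hX hX0
    rw [one_mul, id, norm_of_nonneg hX0] at hX
    exact (le_norm_self _).trans hX
  filter_upwards [eventually_ge_atTop 1, tendsto_log_atTop.eventually_ge_atTop 3,
    (tendsto_sieveLevel_atTop k).eventually_ge_atTop 3,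
    (tendsto_sieveLevel_atTop k).eventually_ge_atTop (k + 1), eventually_pow_le,
    tendsto_log_atTop.eventually_ge_atTop (log k.factorial)]
    with X one_le_X three_le_log three_le_level add_one_le_level pow_le factorial_le
  rintro H rfl hH a M ha hM
  refine card_prime_translates_le_of_large (by linarith) three_le_log three_le_level
    add_one_le_level pow_le ?_ ha hM
  calc log (tupleModulus H) ≤ log (#H).factorial + (#H : ℝ) ^ 2 * log (X ^ m) :=
        log_tupleModulus_le (one_le_pow₀ one_le_X) hH
    _ ≤ log X + (#H : ℝ) ^ 2 * (m * log X) := by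
        rw [log_pow]
        gcongr
    _ = E * log X := by ring

end SieveParameters

section Chebyshev

open Real Filter

lemma pow_factorization_centralBinom_le {n p : ℕ} (hn : 2 < n) (hp : p.Prime) :
    p ^ n.centralBinom.factorization p ≤
      (if p ≤ Nat.sqrt (2 * n) then 2 * n else 1) *
        ((if p ≤ 2 * n / 3 then p else 1) * (if n < p then 2 * n else 1)) := by
  have le_two_mul : p ^ n.centralBinom.factorization p ≤ 2 * n :=
    Nat.pow_factorization_choose_le (by lia)
  have one_lt_p := hp.one_lt
  have one_le_second : 1 ≤ if p ≤ 2 * n / 3 then p else 1 := by split_ifs <;> lia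
  have one_le_third : 1 ≤ if n < p then 2 * n else 1 := by split_ifs <;> lia
  by_cases h_sqrt : p ≤ Nat.sqrt (2 * n)
  · rw [if_pos h_sqrt]
    exact le_mul_of_le_of_one_le le_two_mul (one_le_mul one_le_second one_le_third)
  rw [if_neg h_sqrt, one_mul]
  have le_self : p ^ n.centralBinom.factorization p ≤ p :=
    (Nat.pow_le_pow_right hp.pos (Nat.factorization_choose_le_one
      (Nat.sqrt_lt'.1 (not_le.1 h_sqrt)))).trans_eq (pow_one p)
  by_cases h_third : p ≤ 2 * n / 3
  · rw [if_pos h_third]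
    exact le_mul_of_le_of_one_le le_self one_le_third
  rw [if_neg h_third, one_mul]
  by_cases h_half : n < p
  · rwa [if_pos h_half]
  rw [if_neg h_half, Nat.factorization_centralBinom_of_two_mul_self_lt_three_mul hn
    (not_lt.1 h_half) (by lia), pow_zero]

theorem centralBinom_le_mul_pow_card_primes {n : ℕ} (hn : 2 < n) :
    n.centralBinom ≤ (2 * n) ^ Nat.sqrt (2 * n) *
      (4 ^ (2 * n / 3) * (2 * n) ^ #{p ∈ Ioc n (2 * n) | p.Prime}) := by
  have prod_eq : ∏ p ∈ Nat.primesLE (2 * n), p ^ n.centralBinom.factorization p =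
      n.centralBinom := by
    rw [Nat.primesLE_eq_filter_range]
    refine (prod_filter_of_ne fun p _ h => ?_).trans (Nat.prod_pow_factorization_centralBinom n)
    contrapose h
    rw [Nat.factorization_eq_zero_of_not_prime _ h, pow_zero]
  have small : ∏ p ∈ Nat.primesLE (2 * n), (if p ≤ Nat.sqrt (2 * n) then 2 * n else 1) ≤
      (2 * n) ^ Nat.sqrt (2 * n) := by
    rw [← prod_filter, prod_const]
    refine Nat.pow_le_pow_right (by lia) ?_
    calc _ ≤ #(Ioc 0 (Nat.sqrt (2 * n))) := card_le_card fun p hp => by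
          rw [mem_filter] at hp
          exact mem_Ioc.2 ⟨(Nat.prime_of_mem_primesLE hp.1).pos, hp.2⟩
      _ = _ := Nat.card_Ioc 0 _
  have middle : ∏ p ∈ Nat.primesLE (2 * n), (if p ≤ 2 * n / 3 then p else 1) ≤
      4 ^ (2 * n / 3) := by
    rw [← prod_filter]
    refine (prod_le_prod_of_subset_of_one_le' (fun p hp => ?_) fun p hp _ =>
      (Nat.prime_of_mem_primesLE hp).one_lt.le).trans (primorial_le_four_pow (2 * n / 3))
    rw [mem_filter] at hp
    exact Nat.mem_primesLE.2 ⟨hp.2, Nat.prime_of_mem_primesLE hp.1⟩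
  have large : ∏ p ∈ Nat.primesLE (2 * n), (if n < p then 2 * n else 1) =
      (2 * n) ^ #{p ∈ Ioc n (2 * n) | p.Prime} := by
    rw [← prod_filter, prod_const]
    congr 2
    ext p
    simp only [mem_filter, Nat.mem_primesLE, mem_Ioc]
    tauto
  calc n.centralBinom ≤ ∏ p ∈ Nat.primesLE (2 * n), (if p ≤ Nat.sqrt (2 * n) then 2 * n else 1) *
        ((if p ≤ 2 * n / 3 then p else 1) * (if n < p then 2 * n else 1)) := by
        rw [← prod_eq]
        exact prod_le_prod' fun p hp =>
          pow_factorization_centralBinom_le hn (Nat.prime_of_mem_primesLE hp)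
    _ ≤ _ := by
        rw [prod_mul_distrib, prod_mul_distrib, large]
        gcongr

lemma log_two_mul_le_card_primes {n : ℕ} (hn : 4 ≤ n) :
    log 2 / 3 * (2 * n) - 2 * (√(2 * n) * log (2 * n)) ≤
      #{p ∈ Ioc n (2 * n) | p.Prime} * log (2 * n) := by
  set m := #{p ∈ Ioc n (2 * n) | p.Prime}
  have n_pos : (0 : ℝ) < n := by positivity
  have one_le_two_mul : (1 : ℝ) ≤ 2 * n := by exact_mod_cast (by lia : 1 ≤ 2 * n)
  have log_nonneg : 0 ≤ log (2 * n) := log_nonneg one_le_two_mul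
  have log_four_pow_le : n * log 4 ≤ log n + (Nat.sqrt (2 * n) * log (2 * n)
      + ((2 * n / 3 : ℕ) * log 4 + m * log (2 * n))) := by
    have four_pow_le : (4 : ℝ) ^ n ≤
        n * ((2 * n) ^ Nat.sqrt (2 * n) * (4 ^ (2 * n / 3) * (2 * n) ^ m)) := by
      exact_mod_cast (Nat.four_pow_lt_mul_centralBinom n hn).le.trans
        (Nat.mul_le_mul_left n (centralBinom_le_mul_pow_card_primes (by lia)))
    have := log_le_log (by positivity) four_pow_le
    rwa [log_mul (by positivity) (by positivity), log_mul (by positivity) (by positivity),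
      log_mul (by positivity) (by positivity), log_pow, log_pow, log_pow, log_pow] at this
  have log_n_le : log n ≤ √(2 * n) * log (2 * n) :=
    (log_le_log n_pos (by linarith)).trans
      (le_mul_of_one_le_left log_nonneg (one_le_sqrt.2 one_le_two_mul))
  have sqrt_le : Nat.sqrt (2 * n) * log (2 * n) ≤ √(2 * n) * log (2 * n) := by
    gcongr
    exact_mod_cast nat_sqrt_le_real_sqrt (a := 2 * n)
  have div_le : (2 * n / 3 : ℕ) * log 4 ≤ 2 * n / 3 * log 4 := by
    gcongr
    exact_mod_cast Nat.cast_div_le (α := ℝ) (m := 2 * n) (n := 3)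
  rw [log_four_eq] at log_four_pow_le div_le
  linarith

lemma finite_dyadicPrimes (X : ℝ) : (dyadicPrimes X).Finite :=
  (Set.finite_Iic ⌊2 * X⌋₊).subset fun _ hp => Nat.le_floor hp.2.2

lemma eventually_sqrt_mul_log_le {ε : ℝ} (hε : 0 < ε) : ∀ᶠ x : ℝ in atTop, √x * log x ≤ ε * x := by
  filter_upwards [(isLittleO_log_rpow_atTop (r := 1 / 2) (by norm_num)).bound hε,
    eventually_ge_atTop 0] with x hx hx0
  rw [← sqrt_eq_rpow, norm_of_nonneg (sqrt_nonneg x)] at hx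
  calc √x * log x ≤ √x * (ε * √x) := by
        gcongr
        exact (le_norm_self _).trans hx
    _ = ε * x := by rw [mul_left_comm, mul_self_sqrt hx0]

lemma card_primes_Ioc_floor_le_ncard_dyadicPrimes {X : ℝ} (hX : 0 ≤ X) :
    #{p ∈ Ioc ⌊X⌋₊ (2 * ⌊X⌋₊) | p.Prime} ≤ (dyadicPrimes X).ncard := by
  rw [← Set.ncard_coe_finset]
  refine Set.ncard_le_ncard (fun p hp => ?_) (finite_dyadicPrimes X)
  rw [mem_coe, mem_filter, mem_Ioc] at hp
  have p_le : (p : ℝ) ≤ 2 * ⌊X⌋₊ := by exact_mod_cast hp.1.2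
  exact ⟨hp.2, ((Nat.floor_lt hX).1 hp.1.1).le, by linarith [Nat.floor_le hX]⟩

theorem eventually_le_ncard_dyadicPrimes :
    ∀ᶠ X : ℝ in atTop, X / (20 * log X) ≤ (dyadicPrimes X).ncard := by
  have tendsto_floor : Tendsto (fun X : ℝ => 2 * (⌊X⌋₊ : ℝ)) atTop atTop :=
    (tendsto_natCast_atTop_atTop.comp tendsto_nat_floor_atTop).const_mul_atTop two_pos
  filter_upwards [tendsto_floor.eventually (eventually_sqrt_mul_log_le (ε := 1 / 20) (by norm_num)),
    eventually_ge_atTop 4] with X sqrt_mul_log_le four_le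
  have floor_le : (⌊X⌋₊ : ℝ) ≤ X := Nat.floor_le (by linarith)
  have four_le_floor : 4 ≤ ⌊X⌋₊ := Nat.le_floor (by exact_mod_cast four_le)
  have two_mul_floor_ge : (1 : ℝ) ≤ 2 * ⌊X⌋₊ := by exact_mod_cast (by lia : 1 ≤ 2 * ⌊X⌋₊)
  have log_pos : 0 < log X := log_pos (by linarith)
  have log_le : log (2 * ⌊X⌋₊) ≤ 2 * log X :=
    calc log (2 * ⌊X⌋₊) ≤ log (X ^ 2) := log_le_log (by linarith) (by nlinarith)
      _ = 2 * log X := by rw [log_pow, Nat.cast_ofNat]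
  have card_mul_log_le : #{p ∈ Ioc ⌊X⌋₊ (2 * ⌊X⌋₊) | p.Prime} * log (2 * ⌊X⌋₊) ≤
      (dyadicPrimes X).ncard * (2 * log X) :=
    mul_le_mul (by exact_mod_cast card_primes_Ioc_floor_le_ncard_dyadicPrimes (by linarith)) log_le
      (log_nonneg two_mul_floor_ge) (Nat.cast_nonneg _)
  rw [div_le_iff₀ (by positivity)]
  nlinarith [log_two_mul_le_card_primes four_le_floor, log_two_gt_d9, Nat.lt_floor_add_one X]

end Chebyshev

section GapVectors

open MeasureTheory Real Filter

lemma lt_nextPrime (n : ℕ) : n < nextPrime n := by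
  classical exact (Nat.find_spec (exists_prime_gt n)).1

lemma prime_nextPrime (n : ℕ) : (nextPrime n).Prime := by
  classical exact (Nat.find_spec (exists_prime_gt n)).2

lemma nextPrime_le_two_mul {n : ℕ} (hn : n ≠ 0) : nextPrime n ≤ 2 * n := by
  classical
  obtain ⟨p, hp, lt, le⟩ := Nat.exists_prime_lt_and_le_two_mul n hn
  exact (Nat.find_min' (exists_prime_gt n) ⟨lt, hp⟩).trans le

lemma add_gap (n : ℕ) : n + gap n = nextPrime n := Nat.add_sub_cancel' (lt_nextPrime n).le

lemma prime_iterate_nextPrime {p : ℕ} (hp : p.Prime) (j : ℕ) : (nextPrime^[j] p).Prime := by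
  cases j with
  | zero => exact hp
  | succ j => rw [Function.iterate_succ_apply']; exact prime_nextPrime _

lemma strictMono_iterate_nextPrime (p : ℕ) : StrictMono fun j => nextPrime^[j] p :=
  strictMono_nat_of_lt_succ fun j => by
    rw [Function.iterate_succ_apply']
    exact lt_nextPrime _

lemma le_iterate_nextPrime (p j : ℕ) : p ≤ nextPrime^[j] p :=
  (strictMono_iterate_nextPrime p).monotone j.zero_le

lemma iterate_nextPrime_le {p : ℕ} (hp : p ≠ 0) (j : ℕ) : nextPrime^[j] p ≤ 2 ^ j * p := by
  induction j with
  | zero => rw [Function.iterate_zero_apply, pow_zero, one_mul]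
  | succ j ih =>
    have iterate_ne_zero : nextPrime^[j] p ≠ 0 :=
      ((Nat.pos_of_ne_zero hp).trans_le (le_iterate_nextPrime p j)).ne'
    rw [Function.iterate_succ_apply', pow_succ', mul_assoc]
    exact (nextPrime_le_two_mul iterate_ne_zero).trans (Nat.mul_le_mul_left 2 ih)

lemma add_iterate_nextPrime_sub_of_gapVector_eq {t p q : ℕ} (h : gapVector t p = gapVector t q)
    {j : ℕ} (hj : j ≤ t) : p + (nextPrime^[j] q - q) = nextPrime^[j] p := by
  induction j with
  | zero => simp only [Function.iterate_zero_apply, Nat.sub_self, add_zero]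
  | succ j ih =>
    have gap_eq : gap (nextPrime^[j] p) = gap (nextPrime^[j] q) := congrFun h ⟨j, hj⟩
    rw [Function.iterate_succ_apply', Function.iterate_succ_apply', ← add_gap, ← add_gap, gap_eq]
    have := ih (by lia)
    have := le_iterate_nextPrime q j
    lia

/-- The offsets `nextPrime^[j] q - q` for `j ≤ t`; they depend on `q` only through
`gapVector t q`. -/
def primeOffsets (t q : ℕ) : Finset ℕ := (range (t + 1)).image fun j => nextPrime^[j] q - q

lemma card_primeOffsets (t q : ℕ) : #(primeOffsets t q) = t + 1 := by
  rw [primeOffsets, card_image_of_injective, card_range]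
  refine fun i j hij => (strictMono_iterate_nextPrime q).injective ?_
  exact (tsub_left_inj (le_iterate_nextPrime q i) (le_iterate_nextPrime q j)).1 hij

lemma le_of_mem_primeOffsets {t q h : ℕ} (hq : q ≠ 0) (hh : h ∈ primeOffsets t q) :
    h ≤ 2 ^ t * q := by
  obtain ⟨j, hj, rfl⟩ := mem_image.1 hh
  calc nextPrime^[j] q - q ≤ nextPrime^[j] q := Nat.sub_le _ _
    _ ≤ 2 ^ j * q := iterate_nextPrime_le hq j
    _ ≤ 2 ^ t * q := by
        gcongr
        · exact one_le_two
        · exact Nat.lt_succ_iff.1 (mem_range.1 hj)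

lemma prime_add_of_mem_primeOffsets {t p q h : ℕ} (hp : p.Prime)
    (hpq : gapVector t p = gapVector t q) (hh : h ∈ primeOffsets t q) : (p + h).Prime := by
  obtain ⟨j, hj, rfl⟩ := mem_image.1 hh
  rw [add_iterate_nextPrime_sub_of_gapVector_eq hpq (Nat.lt_succ_iff.1 (mem_range.1 hj))]
  exact prime_iterate_nextPrime hp j

lemma dyadicPrimes_subset_Ico (X : ℝ) :
    dyadicPrimes X ⊆ Ico ⌈X⌉₊ (⌈X⌉₊ + (⌊X⌋₊ + 1)) := by
  intro p hp
  rw [coe_Ico]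
  refine ⟨Nat.ceil_le.2 hp.2.1, ?_⟩
  have : (p : ℝ) < (⌈X⌉₊ + (⌊X⌋₊ + 1) : ℕ) := by
    push_cast
    linarith [hp.2.2, Nat.le_ceil X, Nat.lt_floor_add_one X]
  exact_mod_cast this

theorem exists_ncard_gapVector_eq_le (t : ℕ) :
    ∃ C : ℝ, 0 < C ∧ ∀ᶠ X : ℝ in atTop, ∀ v : Fin t → ℕ,
      ((dyadicPrimes X ∩ gapVector t ⁻¹' {v}).ncard : ℝ) ≤
        C * (X * (log (log X) ^ (9 * (t + 1)) / log X ^ (t + 1))) := by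
  obtain ⟨C, hC, sieve⟩ := exists_card_prime_translates_le (t + 1) 2
  refine ⟨C, hC, ?_⟩
  filter_upwards [sieve, eventually_ge_atTop 1, eventually_ge_atTop (2 ^ (t + 1)),
    tendsto_log_atTop.eventually_ge_atTop 1] with X sieve one_le two_pow_le one_le_log v
  have log_log_nonneg := log_nonneg one_le_log
  rcases Set.eq_empty_or_nonempty (dyadicPrimes X ∩ gapVector t ⁻¹' {v}) with empty | ⟨q, hq, rfl⟩
  · rw [empty, Set.ncard_empty, Nat.cast_zero]
    positivity
  have offset_le : ∀ h ∈ primeOffsets t q, (h : ℝ) ≤ X ^ 2 := fun h hh =>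
    calc (h : ℝ) ≤ 2 ^ t * q := by exact_mod_cast le_of_mem_primeOffsets hq.1.ne_zero hh
      _ ≤ 2 ^ t * (2 * X) := by gcongr; exact hq.2.2
      _ = 2 ^ (t + 1) * X := by ring
      _ ≤ X * X := by gcongr
      _ = X ^ 2 := (sq X).symm
  have fiber_subset : dyadicPrimes X ∩ gapVector t ⁻¹' {gapVector t q} ⊆
      {n ∈ Ico ⌈X⌉₊ (⌈X⌉₊ + (⌊X⌋₊ + 1)) | ∀ h ∈ primeOffsets t q, (n + h).Prime} :=
    fun p hp => mem_coe.2 (mem_filter.2 ⟨mem_coe.1 (dyadicPrimes_subset_Ico X hp.1),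
      fun h => prime_add_of_mem_primeOffsets hp.1.1 hp.2⟩)
  refine le_trans ?_ (sieve _ (card_primeOffsets t q) offset_le ⌈X⌉₊ (⌊X⌋₊ + 1) (Nat.le_ceil X) ?_)
  · rw [← Set.ncard_coe_finset]
    exact_mod_cast Set.ncard_le_ncard fiber_subset (finite_toSet _)
  · push_cast
    linarith [Nat.floor_le (zero_le_one.trans one_le)]

lemma uniformOn_real_eq_ncard_div {Ω : Type*} [MeasurableSpace Ω] [MeasurableSingletonClass Ω]
    {s : Set Ω} (hs : s.Finite) (t : Set Ω) :
    (ProbabilityTheory.uniformOn s).real t = (s ∩ t).ncard / s.ncard := by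
  have count_eq {u : Set Ω} (hu : u.Finite) : Measure.count u = u.ncard := by
    rw [Measure.count_apply_finite u hu, Set.ncard_eq_toFinset_card u hu]
  rw [measureReal_def, ProbabilityTheory.uniformOn, ProbabilityTheory.cond_apply hs.measurableSet,
    count_eq hs, count_eq (hs.inter_of_left t), ENNReal.toReal_mul, ENNReal.toReal_inv,
    ENNReal.toReal_natCast, ENNReal.toReal_natCast, inv_mul_eq_div]

lemma gapVectorLaw_real_singleton (t : ℕ) (X : ℝ) (v : Fin t → ℕ) :
    (gapVectorLaw t X).real {v} =
      (dyadicPrimes X ∩ gapVector t ⁻¹' {v}).ncard / (dyadicPrimes X).ncard := by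
  rw [gapVectorLaw, map_measureReal_apply Measurable.of_discrete (measurableSet_singleton v),
    uniformOn_real_eq_ncard_div (finite_dyadicPrimes X)]

lemma measureReal_coe_finset_le_sum {Ω : Type*} [MeasurableSpace Ω] (μ : Measure Ω)
    (S : Finset Ω) : μ.real S ≤ ∑ v ∈ S, μ.real {v} := by
  have union_bound := measureReal_biUnion_finset_le (μ := μ) S fun v => {v}
  rwa [← set_biUnion_coe, Set.biUnion_of_singleton] at union_bound

theorem exists_gapVectorLaw_real_singleton_le (t : ℕ) :
    ∃ C : ℝ, 0 < C ∧ ∀ᶠ X : ℝ in atTop, ∀ v : Fin t → ℕ,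
      (gapVectorLaw t X).real {v} ≤ C * (log (log X) ^ (9 * (t + 1)) / log X ^ t) := by
  obtain ⟨C, hC, fiber_le⟩ := exists_ncard_gapVector_eq_le t
  refine ⟨20 * C, by positivity, ?_⟩
  filter_upwards [fiber_le, eventually_le_ncard_dyadicPrimes, eventually_gt_atTop 0,
    tendsto_log_atTop.eventually_ge_atTop 1] with X fiber_le le_ncard X_pos one_le_log v
  have log_log_nonneg := log_nonneg one_le_log
  calc (gapVectorLaw t X).real {v}
      ≤ C * (X * (log (log X) ^ (9 * (t + 1)) / log X ^ (t + 1))) / (X / (20 * log X)) := by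
        rw [gapVectorLaw_real_singleton]
        gcongr
        exact fiber_le v
    _ = _ := by
        rw [pow_succ (log X) t]
        field_simp

end GapVectors

end PrimeGaps

theorem mainTheorem7 (t : ℕ) (ht : 1 ≤ t) :
    ∃ C : ℝ, 0 < C ∧ ∃ A : ℕ, ∃ X₀ : ℝ, ∀ X : ℝ, X₀ ≤ X → ∀ S : Finset (Fin t → ℕ),
      (PrimeGaps.gapVectorLaw t X).real (S : Set (Fin t → ℕ)) ≤
        C * ((S.card : ℝ) * Real.log (Real.log (3 * X)) ^ A / Real.log X ^ t) := by
  obtain ⟨C, hC, singleton_le⟩ := PrimeGaps.exists_gapVectorLaw_real_singleton_le t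
  obtain ⟨X₀, hX₀⟩ := Filter.eventually_atTop.1 ((singleton_le.and
    (Filter.eventually_gt_atTop 0)).and (Real.tendsto_log_atTop.eventually_ge_atTop 1))
  refine ⟨C, hC, 9 * (t + 1), X₀, fun X hX S => ?_⟩
  obtain ⟨⟨singleton_le, X_pos⟩, one_le_log⟩ := hX₀ X hX
  have log_log_nonneg := Real.log_nonneg one_le_log
  have log_le : Real.log X ≤ Real.log (3 * X) := Real.log_le_log X_pos (by linarith)
  calc (PrimeGaps.gapVectorLaw t X).real S
      ≤ ∑ v ∈ S, (PrimeGaps.gapVectorLaw t X).real {v} :=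
        PrimeGaps.measureReal_coe_finset_le_sum _ S
    _ ≤ S.card • (C * (Real.log (Real.log X) ^ (9 * (t + 1)) / Real.log X ^ t)) :=
        Finset.sum_le_card_nsmul S _ _ fun v _ => singleton_le v
    _ = C * (S.card * Real.log (Real.log X) ^ (9 * (t + 1)) / Real.log X ^ t) := by
        rw [nsmul_eq_mul]
        ring
    _ ≤ _ := by gcongr
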